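/- Let $n\ge 2$ and let $M$ be a compact smooth $n$-dimensional manifold with boundary, equipped with a Riemannian metric. Let $f: M\to[a,b]\subset\mathbb{R}$ be a smooth Morse function, i.e. a smooth function whose Hessian is non-degenerate at every critical point, and suppose that $f(\partial M)=\{a,b\}$. Suppose that for all $c,d\in[a,b]$ the level sets $f^{-1}(c)$ and $f^{-1}(d)$ are diffeomorphic, that is, there is a bijection $f^{-1}(c)\to f^{-1}(d)$ such that it and its inverse are locally restrictions of smooth maps from open subsets of $M$ to $M$. Then $f$ has no critical points on $M$ (boundary included), and there is a constant $C>0$ such that $\|\nabla f(x)\|\ge C$ for all $x\in M$. -/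

import Mathlib

open Set Manifold Bundle
open scoped ContDiff

noncomputable section

/-- A map `g` from a subset `X` of a manifold `M` to a manifold `N` is smooth if, around every point
of `X`, it is the restriction of a smooth map from an open subset of `M` to `N`. -/
def SmoothOnSubset
    {E : Type*} [NormedAddCommGroup E] [NormedSpace ℝ E] {H : Type*} [TopologicalSpace H]
    (I : ModelWithCorners ℝ E H) {M : Type*} [TopologicalSpace M] [ChartedSpace H M]
    {E' : Type*} [NormedAddCommGroup E'] [NormedSpace ℝ E'] {H' : Type*} [TopologicalSpace H']
    (J : ModelWithCorners ℝ E' H') {N : Type*} [TopologicalSpace N] [ChartedSpace H' N]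
    (X : Set M) (g : X → N) : Prop :=
  ∀ x : X, ∃ U : Set M, IsOpen U ∧ (x : M) ∈ U ∧
    ∃ F : M → N, ContMDiffOn I J ∞ F U ∧ ∀ y : X, (y : M) ∈ U → F y = g y

/-- Two subsets `X`, `Y` of a manifold are diffeomorphic if there is a bijection between them that is
smooth in both directions. No submanifold structure on `X` or `Y` is presupposed; for embedded
submanifolds this is the usual notion. -/
def DiffeomorphicSubsets
    {E : Type*} [NormedAddCommGroup E] [NormedSpace ℝ E] {H : Type*} [TopologicalSpace H]
    (I : ModelWithCorners ℝ E H) {M : Type*} [TopologicalSpace M] [ChartedSpace H M]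
    (X Y : Set M) : Prop :=
  ∃ e : X ≃ Y, SmoothOnSubset I I X (fun x => (e x : M)) ∧
    SmoothOnSubset I I Y (fun y => (e.symm y : M))

/-- A critical point of a real function on a manifold: a point where the differential vanishes. -/
def IsCriticalPt
    {E : Type*} [NormedAddCommGroup E] [NormedSpace ℝ E] {H : Type*} [TopologicalSpace H]
    (I : ModelWithCorners ℝ E H) {M : Type*} [TopologicalSpace M] [ChartedSpace H M]
    (f : M → ℝ) (x : M) : Prop :=
  mfderiv I 𝓘(ℝ, ℝ) f x = 0

/-- The second derivative at `x` of `f` read in the preferred chart at `x`. At a critical point this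
is the Hessian of `f`, and whether it is degenerate does not depend on the chart. -/
def chartHessian
    {E : Type*} [NormedAddCommGroup E] [NormedSpace ℝ E] {H : Type*} [TopologicalSpace H]
    (I : ModelWithCorners ℝ E H) {M : Type*} [TopologicalSpace M] [ChartedSpace H M]
    (f : M → ℝ) (x : M) : E →L[ℝ] E →L[ℝ] ℝ :=
  fderivWithin ℝ (fderivWithin ℝ (f ∘ (extChartAt I x).symm) (range I)) (range I)
    (extChartAt I x x)

/-- A smooth function whose Hessian is a nondegenerate bilinear form at every critical point. -/
structure IsMorseFunction
    {E : Type*} [NormedAddCommGroup E] [NormedSpace ℝ E] {H : Type*} [TopologicalSpace H]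
    (I : ModelWithCorners ℝ E H) {M : Type*} [TopologicalSpace M] [ChartedSpace H M]
    (f : M → ℝ) : Prop where
  smooth : ContMDiff I 𝓘(ℝ, ℝ) ∞ f
  nondegenerate : ∀ x, IsCriticalPt I f x →
    ∀ u : E, (∀ v : E, chartHessian I f x u v = 0) → u = 0

/-- The gradient of `f` at `x` for a Riemannian metric on `M`: the tangent vector that represents the
differential of `f` at `x` through the inner product of the tangent space. -/
def riemannianGradient
    {E : Type*} [NormedAddCommGroup E] [NormedSpace ℝ E] [FiniteDimensional ℝ E]
    {H : Type*} [TopologicalSpace H]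
    (I : ModelWithCorners ℝ E H) {M : Type*} [TopologicalSpace M] [ChartedSpace H M]
    [RiemannianBundle (fun x : M => TangentSpace I x)]
    (f : M → ℝ) (x : M) : TangentSpace I x :=
  haveI : FiniteDimensional ℝ (TangentSpace I x) := inferInstanceAs (FiniteDimensional ℝ E)
  haveI : CompleteSpace (TangentSpace I x) := FiniteDimensional.complete ℝ (TangentSpace I x)
  (InnerProductSpace.toDual ℝ (TangentSpace I x)).symm (mfderiv I 𝓘(ℝ, ℝ) f x)

end

open Filter Topology Asymptotics

/-! The argument is local and compares tangent cones of level sets. At a critical point `p` with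
Hessian `Q`, `f - f p` is `Q/2` up to `o(‖x - x₀‖ ^ 2)` in a chart. If `p` is interior,
nondegeneracy makes the tangent cone of its level set exactly the null cone of `Q`. A diffeomorphism
onto a regular level would make this cone a hyperplane `W`. But then, in dimension at least 2, `Q (u
+ c • w) (u + c • w)` with `u ∉ W` and `0 ≠ w ∈ W` is a nonconstant affine function of `c`, so it
vanishes somewhere and gives a null vector outside `W`
(`not_diffeomorphic_regular_level_of_nondegenerate`). A regular level to compare with exists because
Morse critical points on a compact manifold are finite in number. The same algebra excludes boundary
critical points: `f` is locally constant on the boundary, so `Q` vanishes on the boundary hyperplane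
and takes both signs on inward vectors, although `f p` is an extreme value
(`exists_lt_and_exists_gt_of_isCriticalPt_boundary`). The gradient bound is then compactness. -/

/-! ### Second-order expansion at a critical point, on a convex set. -/

theorem isLittleO_sub_quadratic_of_hasFDerivWithinAt
    {E : Type*} [NormedAddCommGroup E] [NormedSpace ℝ E] {s : Set E} (hs : Convex ℝ s)
    {x₀ : E} (hx₀ : x₀ ∈ s) {φ : E → ℝ} {φ' : E → E →L[ℝ] ℝ} {Q : E →L[ℝ] E →L[ℝ] ℝ}
    (hφ : ∀ᶠ x in 𝓝[s] x₀, HasFDerivWithinAt φ (φ' x) s x) (h0 : φ' x₀ = 0)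
    (hQ : HasFDerivWithinAt φ' Q s x₀) (hsymm : ∀ u v, Q u v = Q v u) :
    (fun x => φ x - φ x₀ - 2⁻¹ * Q (x - x₀) (x - x₀)) =o[𝓝[s] x₀] fun x => ‖x - x₀‖ ^ 2 := by
  rw [isLittleO_iff]
  intro ε hε
  have h1 := hφ.and (hQ.isLittleO.def hε)
  rw [eventually_nhdsWithin_iff, Metric.eventually_nhds_iff] at h1
  obtain ⟨δ, hδ, h1⟩ := h1
  rw [eventually_nhdsWithin_iff, Metric.eventually_nhds_iff]
  refine ⟨δ, hδ, fun x hx hxs => ?_⟩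
  set r := ‖x - x₀‖ with hr
  -- Mean value inequality for `φ - Q/2`: on the ball of radius `r` its derivative is at most `ε *
  -- r`, since `φ'` vanishes at `x₀` and has derivative `Q` there.
  have key := Convex.norm_image_sub_le_of_norm_hasFDerivWithin_le (𝕜 := ℝ)
    (s := s ∩ Metric.closedBall x₀ r)
    (f := fun y => φ y - 2⁻¹ * Q (y - x₀) (y - x₀)) (f' := fun y => φ' y - Q (y - x₀))
    (C := ε * r) (x := x₀) (y := x) ?_ ?_ (hs.inter (convex_closedBall _ _))
    ⟨hx₀, by simp [hr]⟩ ⟨hxs, by simp [hr, dist_eq_norm]⟩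
  · simp only [sub_self, map_zero, mul_zero, sub_zero] at key
    calc _ = ‖φ x - 2⁻¹ * Q (x - x₀) (x - x₀) - φ x₀‖ := by congr 1; ring
      _ ≤ _ := key
      _ = _ := by rw [norm_pow, norm_norm]; ring
  · rintro y ⟨hys, hy⟩
    have hyδ : dist y x₀ < δ := lt_of_le_of_lt hy (by simpa [hr, dist_eq_norm] using hx)
    have hd : HasFDerivAt (fun y => 2⁻¹ * Q (y - x₀) (y - x₀)) (Q (y - x₀)) y := by
      have hid : HasFDerivAt (fun y : E => y - x₀) (ContinuousLinearMap.id ℝ E) y :=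
        (hasFDerivAt_id y).sub_const x₀
      have := ((Q.hasFDerivAt.comp y hid).clm_apply hid).const_mul (2⁻¹ : ℝ)
      refine this.congr_fderiv ?_
      ext v
      simp [hsymm v]
      ring
    exact ((h1 hyδ hys).1.mono inter_subset_left).sub hd.hasFDerivWithinAt
  · rintro y ⟨hys, hy⟩
    have hyδ : dist y x₀ < δ := lt_of_le_of_lt hy (by simpa [hr, dist_eq_norm] using hx)
    have := (h1 hyδ hys).2
    rw [h0, sub_zero] at this
    refine this.trans ?_
    gcongr
    simpa [dist_eq_norm] using hy

theorem tendsto_second_difference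
    {E : Type*} [NormedAddCommGroup E] [NormedSpace ℝ E] {s : Set E}
    {x₀ : E} {φ : E → ℝ} {Q : E →L[ℝ] E →L[ℝ] ℝ}
    (h : (fun x => φ x - φ x₀ - 2⁻¹ * Q (x - x₀) (x - x₀)) =o[𝓝[s] x₀] fun x => ‖x - x₀‖ ^ 2)
    {v : E} (hv : ∀ᶠ t : ℝ in 𝓝[>] 0, x₀ + t • v ∈ s) :
    Tendsto (fun t : ℝ => (φ (x₀ + t • v) - φ x₀) / t ^ 2) (𝓝[>] 0) (𝓝 (2⁻¹ * Q v v)) := by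
  have hc : Tendsto (fun t : ℝ => x₀ + t • v) (𝓝[>] 0) (𝓝[s] x₀) := by
    refine tendsto_nhdsWithin_iff.2 ⟨?_, hv⟩
    have : Continuous fun t : ℝ => x₀ + t • v := by fun_prop
    exact (this.tendsto' 0 x₀ (by simp)).mono_left nhdsWithin_le_nhds
  have h1 := h.comp_tendsto hc
  have h2 : (fun t : ℝ => φ (x₀ + t • v) - φ x₀ - 2⁻¹ * (t ^ 2 * Q v v)) =o[𝓝[>] 0]
      fun t : ℝ => t ^ 2 := by
    have : (fun t : ℝ => ‖t • v‖ ^ 2) =O[𝓝[>] (0 : ℝ)] fun t : ℝ => t ^ 2 := by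
      refine IsBigO.of_bound (‖v‖ ^ 2) (Eventually.of_forall fun t => ?_)
      simp [norm_smul, mul_pow, mul_comm]
    refine (IsLittleO.trans_isBigO ?_ this)
    refine h1.congr (fun t => ?_) (fun t => ?_)
    · simp; ring
    · simp
  have h3 := h2.tendsto_div_nhds_zero.add_const (2⁻¹ * Q v v)
  rw [zero_add] at h3
  refine h3.congr' ?_
  filter_upwards [self_mem_nhdsWithin] with t (ht : 0 < t)
  field_simp
  ring

theorem eventually_lt_of_quadratic_pos
    {E : Type*} [NormedAddCommGroup E] [NormedSpace ℝ E] {s : Set E}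
    {x₀ : E} {φ : E → ℝ} {Q : E →L[ℝ] E →L[ℝ] ℝ}
    (h : (fun x => φ x - φ x₀ - 2⁻¹ * Q (x - x₀) (x - x₀)) =o[𝓝[s] x₀] fun x => ‖x - x₀‖ ^ 2)
    {v : E} (hv : ∀ᶠ t : ℝ in 𝓝[>] 0, x₀ + t • v ∈ s) (hQ : 0 < Q v v) :
    ∀ᶠ t : ℝ in 𝓝[>] 0, φ x₀ < φ (x₀ + t • v) := by
  have := (tendsto_second_difference h hv).eventually_const_lt (u := 0) (by positivity)
  filter_upwards [this, self_mem_nhdsWithin] with t ht (ht0 : 0 < t)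
  have := (div_pos_iff_of_pos_right (by positivity : (0 : ℝ) < t ^ 2)).1 ht
  linarith

theorem eventually_gt_of_quadratic_neg
    {E : Type*} [NormedAddCommGroup E] [NormedSpace ℝ E] {s : Set E}
    {x₀ : E} {φ : E → ℝ} {Q : E →L[ℝ] E →L[ℝ] ℝ}
    (h : (fun x => φ x - φ x₀ - 2⁻¹ * Q (x - x₀) (x - x₀)) =o[𝓝[s] x₀] fun x => ‖x - x₀‖ ^ 2)
    {v : E} (hv : ∀ᶠ t : ℝ in 𝓝[>] 0, x₀ + t • v ∈ s) (hQ : Q v v < 0) :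
    ∀ᶠ t : ℝ in 𝓝[>] 0, φ (x₀ + t • v) < φ x₀ := by
  have := (tendsto_second_difference h hv).eventually_lt_const (u := 0) (by linarith)
  filter_upwards [this, self_mem_nhdsWithin] with t ht (ht0 : 0 < t)
  have := mul_neg_of_neg_of_pos ht (by positivity : (0 : ℝ) < t ^ 2)
  rw [div_mul_cancel₀ _ (by positivity)] at this
  linarith

theorem quadratic_eq_zero_of_constant_on_ray
    {E : Type*} [NormedAddCommGroup E] [NormedSpace ℝ E] {s : Set E}
    {x₀ : E} {φ : E → ℝ} {Q : E →L[ℝ] E →L[ℝ] ℝ}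
    (h : (fun x => φ x - φ x₀ - 2⁻¹ * Q (x - x₀) (x - x₀)) =o[𝓝[s] x₀] fun x => ‖x - x₀‖ ^ 2)
    {v : E} (hv : ∀ᶠ t : ℝ in 𝓝[>] 0, x₀ + t • v ∈ s)
    (hc : ∀ᶠ t : ℝ in 𝓝[>] 0, φ (x₀ + t • v) = φ x₀) : Q v v = 0 := by
  by_contra hne
  rcases lt_or_gt_of_ne hne with hlt | hgt
  · obtain ⟨t, h1, h2⟩ := (hc.and (eventually_gt_of_quadratic_neg h hv hlt)).exists
    exact h2.ne h1
  · obtain ⟨t, h1, h2⟩ := (hc.and (eventually_lt_of_quadratic_pos h hv hgt)).exists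
    exact h2.ne' h1

/-! ### Tangent cones of level sets. -/

/-- On the level set the expansion reads `Q d d = o(‖d‖ ^ 2)`; homogeneity of degree 2 carries this
over to the rescaled vectors `c n • d n → v`. -/
theorem quadratic_eq_zero_of_mem_tangentConeAt
    {E : Type*} [NormedAddCommGroup E] [NormedSpace ℝ E]
    {x₀ : E} {φ : E → ℝ} {Q : E →L[ℝ] E →L[ℝ] ℝ}
    (h : (fun x => φ x - φ x₀ - 2⁻¹ * Q (x - x₀) (x - x₀)) =o[𝓝 x₀] fun x => ‖x - x₀‖ ^ 2)
    {v : E} (hv : v ∈ tangentConeAt ℝ {x | φ x = φ x₀} x₀) : Q v v = 0 := by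
  obtain ⟨α, l, hl, c, d, hd, hmem, hcd⟩ := exists_fun_of_mem_tangentConeAt hv
  have hxd : Tendsto (fun n => x₀ + d n) l (𝓝 x₀) := by simpa using hd.const_add x₀
  have h1 := h.comp_tendsto hxd
  have h2 : (fun n => Q (d n) (d n)) =o[l] fun n => ‖d n‖ ^ 2 := by
    have h3 := h1.const_mul_left (-2)
    refine h3.congr' ?_ (Eventually.of_forall fun n => by simp)
    filter_upwards [hmem] with n (hn : φ (x₀ + d n) = φ x₀)
    simp only [Function.comp_apply, hn, add_sub_cancel_left]
    ring
  have h3 : (fun n => Q (c n • d n) (c n • d n)) =o[l] fun n => ‖c n • d n‖ ^ 2 := by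
    refine ((isBigO_refl (fun n => (c n) ^ 2) l).mul_isLittleO h2).congr ?_ ?_
    · exact fun n => by simp; ring
    · exact fun n => by simp [norm_smul, mul_pow]
  have h4 : Tendsto (fun n => Q (c n • d n) (c n • d n)) l (𝓝 (Q v v)) := by
    have : Continuous fun w => Q w w := by fun_prop
    exact (this.tendsto v).comp hcd
  have h5 : (fun n => ‖c n • d n‖ ^ 2) =O[l] fun _ => (1 : ℝ) :=
    ((hcd.norm.pow 2).isBigO_one ℝ)
  exact tendsto_nhds_unique h4 ((isLittleO_one_iff ℝ).1 (h3.trans_isBigO h5))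

/-- Sign changes of `φ - φ x₀` across the direction `v` force a tangent direction of the level set. -/
theorem mem_tangentConeAt_levelSet
    {E : Type*} [NormedAddCommGroup E] [NormedSpace ℝ E]
    {x₀ : E} {φ : E → ℝ} (hφ : ∀ᶠ x in 𝓝 x₀, ContinuousAt φ x) {v w : E}
    (hpos : ∀ᶠ ε : ℝ in 𝓝[>] 0, ∀ᶠ t : ℝ in 𝓝[>] 0, φ x₀ < φ (x₀ + t • (v + ε • w)))
    (hneg : ∀ᶠ ε : ℝ in 𝓝[>] 0, ∀ᶠ t : ℝ in 𝓝[>] 0, φ (x₀ + t • (v - ε • w)) < φ x₀) :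
    v ∈ tangentConeAt ℝ {x | φ x = φ x₀} x₀ := by
  rw [tangentConeAt_eq_biInter_closure, mem_iInter₂]
  intro U hU
  rw [Metric.mem_closure_iff]
  intro η hη
  have hsmall : ∀ᶠ ε : ℝ in 𝓝[>] 0, ε * ‖w‖ < η := by
    have : Continuous fun ε : ℝ => ε * ‖w‖ := by fun_prop
    exact ((this.tendsto' 0 0 (by simp)).mono_left nhdsWithin_le_nhds).eventually_lt_const hη
  obtain ⟨ε, hp, hn, hεw, hε⟩ :=
    (hpos.and (hneg.and (hsmall.and (self_mem_nhdsWithin (s := Ioi (0 : ℝ)))))).exists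
  replace hε : 0 < ε := hε
  obtain ⟨δ, hδ, hball⟩ : ∃ δ > 0, ∀ z : E, ‖z‖ < δ → z ∈ U ∧ ContinuousAt φ (x₀ + z) := by
    have h1 : ∀ᶠ z : E in 𝓝 0, ContinuousAt φ (x₀ + z) :=
      ((continuous_const_add x₀).tendsto' 0 x₀ (by simp)).eventually hφ
    obtain ⟨δ, hδ, h⟩ := Metric.eventually_nhds_iff.1 ((show ∀ᶠ z in 𝓝 0, z ∈ U from hU).and h1)
    exact ⟨δ, hδ, fun z hz => h (by simpa using hz)⟩
  have htsmall : ∀ᶠ t : ℝ in 𝓝[>] 0, t * (‖v‖ + ε * ‖w‖) < δ := by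
    have : Continuous fun t : ℝ => t * (‖v‖ + ε * ‖w‖) := by fun_prop
    exact ((this.tendsto' 0 0 (by simp)).mono_left nhdsWithin_le_nhds).eventually_lt_const hδ
  obtain ⟨t, htp, htn, htδ, ht⟩ :=
    (hp.and (hn.and (htsmall.and (self_mem_nhdsWithin (s := Ioi (0 : ℝ)))))).exists
  replace ht : 0 < t := ht
  have hbd : ∀ σ ∈ Icc (-ε) ε, ‖t • (v + σ • w)‖ < δ := by
    intro σ hσ
    refine lt_of_le_of_lt ?_ htδ
    rw [norm_smul, Real.norm_of_nonneg ht.le]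
    gcongr
    refine (norm_add_le _ _).trans ?_
    rw [norm_smul]
    gcongr
    exact abs_le.2 hσ
  have hcont : ContinuousOn (fun σ : ℝ => φ (x₀ + t • (v + σ • w))) (Icc (-ε) ε) := by
    intro σ hσ
    have : Continuous fun σ : ℝ => x₀ + t • (v + σ • w) := by fun_prop
    exact (ContinuousAt.comp (g := φ) (f := fun σ : ℝ => x₀ + t • (v + σ • w))
      (hball _ (hbd σ hσ)).2 this.continuousAt).continuousWithinAt
  -- The level set meets the segment from `x₀ + t • (v - ε • w)` to `x₀ + t • (v + ε • w)`;
  -- rescaling by `t⁻¹` gives a direction within `ε * ‖w‖ < η` of `v`.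
  obtain ⟨σ, hσ, hval⟩ := intermediate_value_Icc (by linarith) hcont
    (show φ x₀ ∈ Icc _ _ from ⟨by simpa [sub_eq_add_neg] using htn.le, htp.le⟩)
  refine ⟨v + σ • w, ?_, ?_⟩
  · rw [Set.mem_smul]
    refine ⟨t⁻¹, mem_univ _, t • (v + σ • w), ⟨(hball _ (hbd σ hσ)).1, hval⟩, ?_⟩
    rw [smul_smul, inv_mul_cancel₀ ht.ne', one_smul]
  · rw [dist_eq_norm]
    refine lt_of_le_of_lt ?_ hεw
    rw [sub_add_cancel_left, norm_neg, norm_smul]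
    gcongr
    exact abs_le.2 hσ

/-- Moving a null vector `v` by `±ε • w` changes `Q` by `±2 * ε * Q v w + ε ^ 2 * Q w w`, whose sign
for small `ε` is that of the linear term. -/
theorem mem_tangentConeAt_levelSet_of_quadratic_eq_zero
    {E : Type*} [NormedAddCommGroup E] [NormedSpace ℝ E]
    {x₀ : E} {φ : E → ℝ} (hφ : ∀ᶠ x in 𝓝 x₀, ContinuousAt φ x) {Q : E →L[ℝ] E →L[ℝ] ℝ}
    (h : (fun x => φ x - φ x₀ - 2⁻¹ * Q (x - x₀) (x - x₀)) =o[𝓝 x₀] fun x => ‖x - x₀‖ ^ 2)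
    (hsymm : ∀ u v, Q u v = Q v u) {v w : E} (hv : Q v v = 0) (hvw : Q v w ≠ 0) :
    v ∈ tangentConeAt ℝ {x | φ x = φ x₀} x₀ := by
  wlog hw : 0 < Q v w generalizing w
  · exact this (w := -w) (by simpa) (by
      rw [map_neg]; exact neg_pos.2 (lt_of_le_of_ne (not_lt.1 hw) hvw))
  have hsmall : ∀ᶠ ε : ℝ in 𝓝[>] 0, ε * |Q w w| < 2 * Q v w := by
    have : Continuous fun ε : ℝ => ε * |Q w w| := by fun_prop
    exact ((this.tendsto' 0 0 (by simp)).mono_left nhdsWithin_le_nhds).eventually_lt_const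
      (by positivity)
  rw [← nhdsWithin_univ] at h
  refine mem_tangentConeAt_levelSet hφ (w := w) ?_ ?_
  · filter_upwards [hsmall, self_mem_nhdsWithin] with ε h1 (hε : 0 < ε)
    refine eventually_lt_of_quadratic_pos h (by simp) ?_
    have : Q (v + ε • w) (v + ε • w) = ε * (2 * Q v w + ε * Q w w) := by
      simp [hv, hsymm w v]; ring
    rw [this]
    have h2 : -(ε * |Q w w|) ≤ ε * Q w w := by
      rw [← mul_neg]; gcongr; exact neg_abs_le _
    exact mul_pos hε (by linarith)
  · filter_upwards [hsmall, self_mem_nhdsWithin] with ε h1 (hε : 0 < ε)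
    refine eventually_gt_of_quadratic_neg h (by simp) ?_
    have : Q (v - ε • w) (v - ε • w) = ε * (ε * Q w w - 2 * Q v w) := by
      simp [hv, hsymm w v]; ring
    rw [this]
    have h2 : ε * Q w w ≤ ε * |Q w w| := by gcongr; exact le_abs_self _
    exact mul_neg_of_pos_of_neg hε (by linarith)

theorem tendsto_first_difference
    {E : Type*} [NormedAddCommGroup E] [NormedSpace ℝ E] {x₀ : E} {ψ : E → ℝ} {ψ' : E →L[ℝ] ℝ}
    (h : HasFDerivAt ψ ψ' x₀) (v : E) :
    Tendsto (fun t : ℝ => t⁻¹ * (ψ (x₀ + t • v) - ψ x₀)) (𝓝[>] 0) (𝓝 (ψ' v)) := by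
  have := (h.hasLineDerivAt v).tendsto_slope_zero_right
  simpa using this

theorem mem_tangentConeAt_levelSet_of_fderiv_eq_zero
    {E : Type*} [NormedAddCommGroup E] [NormedSpace ℝ E]
    {x₀ : E} {ψ : E → ℝ} (hψ : ∀ᶠ x in 𝓝 x₀, ContinuousAt ψ x) {ψ' : E →L[ℝ] ℝ}
    (h : HasFDerivAt ψ ψ' x₀) (h0 : ψ' ≠ 0) {v : E} (hv : ψ' v = 0) :
    v ∈ tangentConeAt ℝ {x | ψ x = ψ x₀} x₀ := by
  obtain ⟨w, hw⟩ : ∃ w, 0 < ψ' w := by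
    obtain ⟨w, hw⟩ := DFunLike.ne_iff.1 h0
    rcases lt_or_gt_of_ne hw with hlt | hgt
    · exact ⟨-w, by simpa using hlt⟩
    · exact ⟨w, by simpa using hgt⟩
  refine mem_tangentConeAt_levelSet hψ (w := w) ?_ ?_
  · filter_upwards [self_mem_nhdsWithin] with ε (hε : 0 < ε)
    have := (tendsto_first_difference h (v + ε • w)).eventually_const_lt (u := 0)
      (by simp [hv]; positivity)
    filter_upwards [this, self_mem_nhdsWithin] with t ht (ht0 : 0 < t)
    linarith [(mul_pos_iff_of_pos_left (inv_pos.2 ht0)).1 ht]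
  · filter_upwards [self_mem_nhdsWithin] with ε (hε : 0 < ε)
    have := (tendsto_first_difference h (v - ε • w)).eventually_lt_const (u := 0)
      (by simp [hv]; positivity)
    filter_upwards [this, self_mem_nhdsWithin] with t ht (ht0 : 0 < t)
    have := mul_neg_of_pos_of_neg ht0 ht
    rw [mul_inv_cancel_left₀ ht0.ne'] at this
    linarith

/-! ### Isotropic hyperplanes, and critical against regular levels. -/

/-- A nondegenerate symmetric form vanishing on a hyperplane `W` takes every value
at vectors outside `W`. -/
theorem exists_quadratic_eq_of_isotropic_hyperplane
    {E : Type*} [NormedAddCommGroup E] [NormedSpace ℝ E] {Q : E →L[ℝ] E →L[ℝ] ℝ}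
    (hsymm : ∀ u v, Q u v = Q v u) (hnd : ∀ u, (∀ v, Q u v = 0) → u = 0)
    {W : Submodule ℝ E} (hW : ∀ w ∈ W, Q w w = 0) {u w : E} (hu : W ⊔ Submodule.span ℝ {u} = ⊤)
    (hw : w ∈ W) (hw0 : w ≠ 0) (r : ℝ) :
    ∃ c : ℝ, Q (u + c • w) (u + c • w) = r := by
  have hpol : ∀ w' ∈ W, Q w w' = 0 := by
    intro w' hw'
    have h1 := hW _ (W.add_mem hw hw')
    simp [hW _ hw, hW _ hw', hsymm w' w] at h1
    exact h1
  have hwu : Q w u ≠ 0 := by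
    intro h0
    refine hw0 (hnd w fun v => ?_)
    have hv : v ∈ W ⊔ Submodule.span ℝ {u} := hu ▸ Submodule.mem_top
    obtain ⟨w', hw', z, hz, rfl⟩ := Submodule.mem_sup.1 hv
    obtain ⟨k, rfl⟩ := Submodule.mem_span_singleton.1 hz
    simp [hpol w' hw', h0]
  -- Since `Q w w = 0`, the value at `u + c • w` is `Q u u + 2 * c * Q w u`, affine in `c`.
  refine ⟨(r - Q u u) / (2 * Q w u), ?_⟩
  simp [hW _ hw, hsymm u w]
  field_simp
  ring

/-- The level set of a function through a nondegenerate critical point is not locally diffeomorphic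
to a regular level set. -/
theorem not_diffeomorphic_regular_level_of_nondegenerate
    {E : Type*} [NormedAddCommGroup E] [NormedSpace ℝ E] [FiniteDimensional ℝ E]
    (hE : 2 ≤ Module.finrank ℝ E) {φ ψ : E → ℝ} {F G : E → E} {x₀ y₀ : E}
    {Q : E →L[ℝ] E →L[ℝ] ℝ} {ψ' : E →L[ℝ] ℝ} {A B : E →L[ℝ] E}
    (hφ : ∀ᶠ x in 𝓝 x₀, ContinuousAt φ x) (hψ : ∀ᶠ y in 𝓝 y₀, ContinuousAt ψ y)
    (hQ : (fun x => φ x - φ x₀ - 2⁻¹ * Q (x - x₀) (x - x₀)) =o[𝓝 x₀] fun x => ‖x - x₀‖ ^ 2)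
    (hsymm : ∀ u v, Q u v = Q v u) (hnd : ∀ u, (∀ v, Q u v = 0) → u = 0)
    (hψ' : HasFDerivAt ψ ψ' y₀) (hne : ψ' ≠ 0)
    (hF : HasFDerivAt F B x₀) (hG : HasFDerivAt G A y₀) (hFx : F x₀ = y₀) (hGy : G y₀ = x₀)
    (hFG : ∀ᶠ x in 𝓝 x₀, φ x = φ x₀ → ψ (F x) = ψ y₀ ∧ G (F x) = x)
    (hGF : ∀ᶠ y in 𝓝 y₀, ψ y = ψ y₀ → φ (G y) = φ x₀ ∧ F (G y) = y) : False := by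
  set X := {x | φ x = φ x₀} with hX
  set Y := {y | ψ y = ψ y₀} with hY
  have hnull : ∀ v, Q v v = 0 → v ∈ tangentConeAt ℝ X x₀ := by
    intro v hv
    by_cases hv0 : v = 0
    · subst hv0
      exact zero_mem_tangentConeAt (subset_closure (by simp [hX]))
    · have : ∃ w, Q v w ≠ 0 := by
        by_contra! h
        exact hv0 (hnd v h)
      obtain ⟨w, hw⟩ := this
      exact mem_tangentConeAt_levelSet_of_quadratic_eq_zero hφ hQ hsymm hv hw
  -- Identities that hold only on a level set can be differentiated only along its tangent cone,
  -- where derivatives within the set are unique.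
  have hBX : ∀ v ∈ tangentConeAt ℝ X x₀, ψ' (B v) = 0 := by
    intro v hv
    have h1 : HasFDerivWithinAt (ψ ∘ F) (ψ'.comp B) X x₀ :=
      ((hFx ▸ hψ').comp x₀ hF).hasFDerivWithinAt
    have h2 : HasFDerivWithinAt (ψ ∘ F) (0 : E →L[ℝ] ℝ) X x₀ := by
      refine (hasFDerivWithinAt_const (ψ y₀) x₀ X).congr_of_eventuallyEq ?_ (by simp [hFx])
      filter_upwards [nhdsWithin_le_nhds hFG, self_mem_nhdsWithin] with x hx hxX using (hx hxX).1
    exact (h1.unique_on h2 hv)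
  have hABX : ∀ v ∈ tangentConeAt ℝ X x₀, A (B v) = v := by
    intro v hv
    have h1 : HasFDerivWithinAt (G ∘ F) (A.comp B) X x₀ :=
      ((hFx ▸ hG).comp x₀ hF).hasFDerivWithinAt
    have h2 : HasFDerivWithinAt (G ∘ F) (ContinuousLinearMap.id ℝ E) X x₀ := by
      refine (hasFDerivWithinAt_id x₀ X).congr_of_eventuallyEq ?_ (by simp [hFx, hGy])
      filter_upwards [nhdsWithin_le_nhds hFG, self_mem_nhdsWithin] with x hx hxX using (hx hxX).2
    exact (h1.unique_on h2 hv)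
  have hBAY : ∀ v, ψ' v = 0 → B (A v) = v := by
    intro v hv
    have hv := mem_tangentConeAt_levelSet_of_fderiv_eq_zero hψ hψ' hne hv
    have h1 : HasFDerivWithinAt (F ∘ G) (B.comp A) Y y₀ :=
      ((hGy ▸ hF).comp y₀ hG).hasFDerivWithinAt
    have h2 : HasFDerivWithinAt (F ∘ G) (ContinuousLinearMap.id ℝ E) Y y₀ := by
      refine (hasFDerivWithinAt_id y₀ Y).congr_of_eventuallyEq ?_ (by simp [hFx, hGy])
      filter_upwards [nhdsWithin_le_nhds hGF, self_mem_nhdsWithin] with y hy hyY using (hy hyY).2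
    exact (h1.unique_on h2 hv)
  have hAY : ∀ v, ψ' v = 0 → Q (A v) (A v) = 0 := by
    intro v hv
    have hv := mem_tangentConeAt_levelSet_of_fderiv_eq_zero hψ hψ' hne hv
    -- `G` maps `Y` into `X` only near `y₀`, so the cone is first localised.
    rw [← tangentConeAt_inter_nhds hGF] at hv
    have := hG.hasFDerivWithinAt.mapsTo_tangent_cone hv
    rw [hGy] at this
    refine quadratic_eq_zero_of_mem_tangentConeAt hQ (tangentConeAt_mono ?_ this)
    rintro _ ⟨y, ⟨hyY, hy⟩, rfl⟩
    exact (hy hyY).1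
  set K := LinearMap.ker ψ'.toLinearMap with hK
  set T : K →ₗ[ℝ] E := A.toLinearMap ∘ₗ K.subtype with hT
  have hTinj : Function.Injective T := by
    intro u v huv
    have h := congrArg B (show A u = A v from huv)
    rw [hBAY u u.2, hBAY v v.2] at h
    exact Subtype.ext h
  set W := LinearMap.range T with hW
  have hKdim : Module.finrank ℝ K + 1 = Module.finrank ℝ E := by
    have h1 := LinearMap.finrank_range_add_finrank_ker ψ'.toLinearMap
    have h2 : LinearMap.range ψ'.toLinearMap = ⊤ := by
      refine LinearMap.range_eq_top.2 (LinearMap.surjective fun h => hne ?_)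
      ext v
      exact DFunLike.congr_fun h v
    rw [h2, finrank_top, Module.finrank_self, ← hK] at h1
    omega
  have hWdim : Module.finrank ℝ W = Module.finrank ℝ K := LinearMap.finrank_range_of_inj hTinj
  obtain ⟨u, huW⟩ : ∃ u, u ∉ W := by
    by_contra! h
    have : W = ⊤ := Submodule.eq_top_iff'.2 h
    rw [this, finrank_top] at hWdim
    omega
  have hsup : W ⊔ Submodule.span ℝ {u} = ⊤ := by
    apply Submodule.eq_top_of_finrank_eq
    have h1 : W < W ⊔ Submodule.span ℝ {u} := by
      refine lt_of_le_of_ne le_sup_left fun h => huW ?_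
      rw [h]
      exact (le_sup_right : _ ≤ W ⊔ Submodule.span ℝ {u}) (Submodule.mem_span_singleton_self u)
    have h2 := Submodule.finrank_lt_finrank_of_lt h1
    have h3 := Submodule.finrank_le (W ⊔ Submodule.span ℝ {u})
    omega
  -- Dimension at least 2 enters here.
  have hWne : W ≠ ⊥ := by
    intro h
    rw [h, finrank_bot] at hWdim
    omega
  obtain ⟨w, hwW, hw0⟩ := W.ne_bot_iff.1 hWne
  have hWQ : ∀ w ∈ W, Q w w = 0 := by
    rintro _ ⟨k, rfl⟩
    exact hAY k k.2
  -- Every null vector `v` equals `A (B v)` with `B v ∈ K`, hence lies in `W`; a null vector `u + c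
  -- • w` would then force `u ∈ W`.
  obtain ⟨c, hc⟩ := exists_quadratic_eq_of_isotropic_hyperplane hsymm hnd hWQ hsup hwW hw0 0
  have hmem := hnull _ hc
  have : u + c • w ∈ W := ⟨⟨B (u + c • w), hBX _ hmem⟩, hABX _ hmem⟩
  exact huW ((W.add_mem_iff_left (W.smul_mem c hwW)).1 this)

/-! ### Critical points in charts: isolation, finiteness, gradient bound. -/

section Charts

variable {E : Type*} [NormedAddCommGroup E] [NormedSpace ℝ E] {H : Type*} [TopologicalSpace H]
  {I : ModelWithCorners ℝ E H} {M : Type*} [TopologicalSpace M] [ChartedSpace H M]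
  {f : M → ℝ}

theorem isCriticalPt_iff (hf : ContMDiff I 𝓘(ℝ, ℝ) ∞ f) (p : M) :
    IsCriticalPt I f p ↔
      fderivWithin ℝ (f ∘ (extChartAt I p).symm) (range I) (extChartAt I p p) = 0 := by
  have : mfderiv I 𝓘(ℝ, ℝ) f p =
      fderivWithin ℝ (f ∘ (extChartAt I p).symm) (range I) (extChartAt I p p) :=
    ((hf p).mdifferentiableAt (by simp)).mfderiv
  rw [IsCriticalPt, this]
  rfl

variable [IsManifold I ∞ M]

theorem contDiffWithinAt_comp_extChartAt_symm (hf : ContMDiff I 𝓘(ℝ, ℝ) ∞ f) (p : M) {y : E}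
    (hy : y ∈ (extChartAt I p).target) :
    ContDiffWithinAt ℝ ∞ (f ∘ (extChartAt I p).symm) (range I) y := by
  rw [← contMDiffWithinAt_iff_contDiffWithinAt]
  exact (hf _).comp_contMDiffWithinAt y (contMDiffWithinAt_extChartAt_symm_range p hy)

theorem fderivWithin_comp_extChartAt_symm (hf : ContMDiff I 𝓘(ℝ, ℝ) ∞ f) (p : M) {x : M}
    (hx : x ∈ (extChartAt I p).source) (v : E) :
    fderivWithin ℝ (f ∘ (extChartAt I p).symm) (range I) (extChartAt I p x) v =
      mfderiv I 𝓘(ℝ, ℝ) f x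
        (mfderivWithin 𝓘(ℝ, E) I (extChartAt I p).symm (range I) (extChartAt I p x) v) := by
  have hy := (extChartAt I p).map_source hx
  have hxy : (extChartAt I p).symm (extChartAt I p x) = x := (extChartAt I p).left_inv hx
  have h1 : MDifferentiableAt I 𝓘(ℝ, ℝ) f ((extChartAt I p).symm (extChartAt I p x)) :=
    (hf _).mdifferentiableAt (by simp)
  have h2 := mdifferentiableWithinAt_extChartAt_symm (I := I) hy
  have h3 := mfderiv_comp_mfderivWithin (I := 𝓘(ℝ, E)) (I' := I) (I'' := 𝓘(ℝ, ℝ))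
    (extChartAt I p x) h1 h2
    ((I.uniqueDiffOn _ (extChartAt_target_subset_range p hy)).uniqueMDiffWithinAt)
  rw [mfderivWithin_eq_fderivWithin] at h3
  -- The base points agree only propositionally, so the tangent spaces are identified through `E`.
  have aux : ∀ z, z = x → ∀ w : E,
      (mfderiv I 𝓘(ℝ, ℝ) f z : E →L[ℝ] ℝ) w = (mfderiv I 𝓘(ℝ, ℝ) f x : E →L[ℝ] ℝ) w := by
    rintro _ rfl w
    rfl
  exact (DFunLike.congr_fun h3 v).trans (aux _ hxy _)

theorem IsCriticalPt.fderivWithin_eq_zero (hf : ContMDiff I 𝓘(ℝ, ℝ) ∞ f) (p : M) {x : M}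
    (hx : x ∈ (extChartAt I p).source) (hc : IsCriticalPt I f x) :
    fderivWithin ℝ (f ∘ (extChartAt I p).symm) (range I) (extChartAt I p x) = 0 := by
  ext v
  rw [fderivWithin_comp_extChartAt_symm hf p hx, show mfderiv I 𝓘(ℝ, ℝ) f x = 0 from hc]
  rfl

theorem hasFDerivWithinAt_chartHessian (hf : ContMDiff I 𝓘(ℝ, ℝ) ∞ f) (p : M) :
    HasFDerivWithinAt (fderivWithin ℝ (f ∘ (extChartAt I p).symm) (range I))
      (chartHessian I f p) (range I) (extChartAt I p p) :=
  (((contDiffWithinAt_comp_extChartAt_symm hf p (mem_extChartAt_target p)).fderivWithin_right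
    (m := 1) I.uniqueDiffOn (by norm_cast) (extChartAt_target_subset_range p
      (mem_extChartAt_target p))).differentiableWithinAt one_ne_zero).hasFDerivWithinAt

theorem chartHessian_symm (hf : ContMDiff I 𝓘(ℝ, ℝ) ∞ f) (p : M) (u v : E) :
    chartHessian I f p u v = chartHessian I f p v u := by
  have hp := extChartAt_target_subset_range p (mem_extChartAt_target (I := I) p)
  refine (contDiffWithinAt_comp_extChartAt_symm hf p
    (mem_extChartAt_target p)).isSymmSndFDerivWithinAt
      (by simpa using (by norm_cast : (2 : ℕ∞ω) ≤ ∞)) I.uniqueDiffOn ?_ hp u v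
  exact I.range_subset_closure_interior hp

theorem IsCriticalPt.isLittleO (hf : ContMDiff I 𝓘(ℝ, ℝ) ∞ f) {p : M}
    (hc : IsCriticalPt I f p) :
    (fun x => (f ∘ (extChartAt I p).symm) x - (f ∘ (extChartAt I p).symm) (extChartAt I p p) -
      2⁻¹ * chartHessian I f p (x - extChartAt I p p) (x - extChartAt I p p))
      =o[𝓝[range I] (extChartAt I p p)] fun x => ‖x - extChartAt I p p‖ ^ 2 := by
  refine isLittleO_sub_quadratic_of_hasFDerivWithinAt I.convex_range
    (extChartAt_target_subset_range p (mem_extChartAt_target p)) ?_ ((isCriticalPt_iff hf p).1 hc)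
    (hasFDerivWithinAt_chartHessian hf p) (chartHessian_symm hf p)
  filter_upwards [extChartAt_target_mem_nhdsWithin (I := I) p] with y hy
  exact ((contDiffWithinAt_comp_extChartAt_symm hf p hy).differentiableWithinAt
    (by simp)).hasFDerivWithinAt

/-- The differential in the chart has the Hessian as its derivative at `p`; in finite dimension an
injective linear map is bounded below, so the differential has an isolated zero. -/
theorem IsMorseFunction.eventually_not_isCriticalPt [FiniteDimensional ℝ E]
    (hf : IsMorseFunction I f) {p : M} (hc : IsCriticalPt I f p) :
    ∀ᶠ x in 𝓝[≠] p, ¬ IsCriticalPt I f x := by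
  have hinj : LinearMap.ker (chartHessian I f p).toLinearMap = ⊥ := by
    refine LinearMap.ker_eq_bot'.2 fun u hu => hf.nondegenerate p hc u fun v => ?_
    exact DFunLike.congr_fun (show chartHessian I f p u = 0 from hu) v
  obtain ⟨C, -, hC⟩ := (chartHessian I f p).toLinearMap.exists_antilipschitzWith hinj
  have h1 := (hasFDerivWithinAt_chartHessian hf.smooth p).eventually_ne (c := 0) ⟨C, hC⟩
  have h2 : Tendsto (extChartAt I p) (𝓝[≠] p) (𝓝[range I \ {extChartAt I p p}]
      (extChartAt I p p)) := by
    refine tendsto_nhdsWithin_iff.2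
      ⟨(continuousAt_extChartAt (I := I) p).tendsto.mono_left nhdsWithin_le_nhds, ?_⟩
    filter_upwards [nhdsWithin_le_nhds (extChartAt_source_mem_nhds (I := I) p),
      self_mem_nhdsWithin] with x hx hxp
    refine ⟨extChartAt_target_subset_range p ((extChartAt I p).map_source hx), fun h => hxp ?_⟩
    exact (extChartAt I p).injOn hx (mem_extChartAt_source p) h
  filter_upwards [h2.eventually h1, nhdsWithin_le_nhds (extChartAt_source_mem_nhds (I := I) p)]
    with x hx hxs hcx
  exact hx (hcx.fderivWithin_eq_zero hf.smooth p hxs)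

theorem exists_eventually_le_norm_fderivWithin_of_not_isCriticalPt (hf : ContMDiff I 𝓘(ℝ, ℝ) ∞ f) {p : M}
    (hc : ¬ IsCriticalPt I f p) :
    ∃ δ > 0, ∀ᶠ x in 𝓝 p,
      δ ≤ ‖fderivWithin ℝ (f ∘ (extChartAt I p).symm) (range I) (extChartAt I p x)‖ := by
  rw [isCriticalPt_iff hf] at hc
  have h0 := norm_pos_iff.2 hc
  refine ⟨_, half_pos h0, ?_⟩
  have hcont : ContinuousWithinAt (fderivWithin ℝ (f ∘ (extChartAt I p).symm) (range I)) (range I)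
    (extChartAt I p p) := (hasFDerivWithinAt_chartHessian hf p).continuousWithinAt
  have h2 : Tendsto (extChartAt I p) (𝓝 p) (𝓝[range I] (extChartAt I p p)) := by
    refine tendsto_nhdsWithin_iff.2 ⟨(continuousAt_extChartAt (I := I) p).tendsto, ?_⟩
    filter_upwards [extChartAt_source_mem_nhds (I := I) p] with x hx
    exact extChartAt_target_subset_range p ((extChartAt I p).map_source hx)
  exact ((hcont.tendsto.comp h2).norm.eventually_const_lt (half_lt_self h0)).mono fun x hx => hx.le

theorem IsMorseFunction.finite_setOf_isCriticalPt [FiniteDimensional ℝ E] [CompactSpace M]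
    (hf : IsMorseFunction I f) : {x | IsCriticalPt I f x}.Finite := by
  by_contra hinf
  obtain ⟨p, hp⟩ := (show {x | IsCriticalPt I f x}.Infinite from hinf).exists_accPt_principal
  rw [accPt_iff_frequently_nhdsNE] at hp
  by_cases hc : IsCriticalPt I f p
  · exact hp (hf.eventually_not_isCriticalPt hc)
  · obtain ⟨δ, hδ, h⟩ := exists_eventually_le_norm_fderivWithin_of_not_isCriticalPt hf.smooth hc
    refine hp ?_
    filter_upwards [nhdsWithin_le_nhds h, nhdsWithin_le_nhds (extChartAt_source_mem_nhds (I := I) p)]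
      with x hx hxs (hcx : IsCriticalPt I f x)
    rw [hcx.fderivWithin_eq_zero hf.smooth p hxs, norm_zero] at hx
    linarith

/-- Near each point the chart differential is at least `δ` and the inverse chart stretches by at
most `C`, so Cauchy–Schwarz bounds the gradient below by `δ / C`. -/
theorem exists_gradient_bound [FiniteDimensional ℝ E] [CompactSpace M]
    [RiemannianBundle (fun x : M => TangentSpace I x)]
    [IsContMDiffRiemannianBundle I ∞ E (fun x : M => TangentSpace I x)]
    (hf : ContMDiff I 𝓘(ℝ, ℝ) ∞ f) (hc : ∀ x, ¬ IsCriticalPt I f x) :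
    ∃ C : ℝ, 0 < C ∧ ∀ x, C ≤ ‖riemannianGradient I f x‖ := by
  have : IsContinuousRiemannianBundle E (fun x : M => TangentSpace I x) := by
    obtain ⟨g, hg, h⟩ := IsContMDiffRiemannianBundle.exists_contMDiff (IB := I) (n := ∞) (F := E)
      (E := fun x : M => TangentSpace I x)
    exact ⟨g, hg.continuous, h⟩
  have hloc : ∀ p : M, ∃ C : ℝ, 0 < C ∧ ∀ᶠ x in 𝓝 p, C ≤ ‖riemannianGradient I f x‖ := by
    intro p
    obtain ⟨δ, hδ, h1⟩ := exists_eventually_le_norm_fderivWithin_of_not_isCriticalPt hf (hc p)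
    obtain ⟨C, hC, h2⟩ := eventually_norm_mfderivWithin_symm_extChartAt_comp_lt I p
    refine ⟨δ / C, by positivity, ?_⟩
    filter_upwards [h1, h2, extChartAt_source_mem_nhds (I := I) p] with x hx1 hx2 hxs
    rw [div_le_iff₀ hC]
    refine hx1.trans (ContinuousLinearMap.opNorm_le_bound _ (by positivity) fun v => ?_)
    rw [fderivWithin_comp_extChartAt_symm hf p hxs]
    let := fun y : E => normedAddCommGroupTangentSpaceVectorSpace y
    let := fun y : E => normedSpaceTangentSpaceVectorSpace y
    set w : TangentSpace I x :=
      mfderivWithin 𝓘(ℝ, E) I (extChartAt I p).symm (range I) (extChartAt I p x) v with hw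
    have hv : ‖w‖ ≤ C * ‖v‖ := by
      have aux : ∀ z, z = x → ∀ u : E,
          ‖(show TangentSpace I z from u)‖ = ‖(show TangentSpace I x from u)‖ := by
        rintro _ rfl u
        rfl
      have h3 := ContinuousLinearMap.le_of_opNorm_le _ hx2.le v
      exact (aux _ ((extChartAt I p).left_inv hxs) _).symm.trans_le h3
    have : FiniteDimensional ℝ (TangentSpace I x) := inferInstanceAs (FiniteDimensional ℝ E)
    have : CompleteSpace (TangentSpace I x) := FiniteDimensional.complete ℝ (TangentSpace I x)
    have hgrad : inner ℝ (riemannianGradient I f x) w = mfderiv I 𝓘(ℝ, ℝ) f x w :=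
      InnerProductSpace.toDual_symm_apply
    rw [← hgrad]
    calc _ ≤ ‖riemannianGradient I f x‖ * ‖w‖ := norm_inner_le_norm _ _
      _ ≤ ‖riemannianGradient I f x‖ * (C * ‖v‖) := by gcongr
      _ = _ := by ring
  have key : ∃ C : ℝ, 0 < C ∧ ∀ x ∈ (univ : Set M), C ≤ ‖riemannianGradient I f x‖ := by
    refine isCompact_univ.induction_on
      (p := fun s => ∃ C : ℝ, 0 < C ∧ ∀ x ∈ s, C ≤ ‖riemannianGradient I f x‖)
      ⟨1, one_pos, by simp⟩ ?_ ?_ ?_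
    · rintro s t hst ⟨C, hC, h⟩
      exact ⟨C, hC, fun x hx => h x (hst hx)⟩
    · rintro s t ⟨C, hC, h⟩ ⟨C', hC', h'⟩
      refine ⟨min C C', lt_min hC hC', ?_⟩
      rintro x (hx | hx)
      · exact (min_le_left _ _).trans (h x hx)
      · exact (min_le_right _ _).trans (h' x hx)
    · intro p _
      obtain ⟨C, hC, h⟩ := hloc p
      exact ⟨_, nhdsWithin_le_nhds h, C, hC, fun x hx => hx⟩
  obtain ⟨C, hC, h⟩ := key
  exact ⟨C, hC, fun x => h x (mem_univ x)⟩

end Charts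

/-! ### Interior and boundary critical points on the manifold. -/

/-- At interior points `range I` is a neighbourhood, so the normed-space obstruction applies to the
chart expressions. -/
theorem no_local_diffeomorphism_critical_regular
    {E : Type*} [NormedAddCommGroup E] [NormedSpace ℝ E] [FiniteDimensional ℝ E]
    (hE : 2 ≤ Module.finrank ℝ E) {H : Type*} [TopologicalSpace H]
    {I : ModelWithCorners ℝ E H} {M : Type*} [TopologicalSpace M] [ChartedSpace H M]
    [IsManifold I ∞ M] {f : M → ℝ} (hf : IsMorseFunction I f) {F G : M → M} {p : M}
    (hp : I.IsInteriorPoint p) (hq : I.IsInteriorPoint (F p))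
    (hcp : IsCriticalPt I f p) (hcq : ¬ IsCriticalPt I f (F p))
    (hF : MDifferentiableAt I I F p) (hG : MDifferentiableAt I I G (F p)) (hGp : G (F p) = p)
    (hFG : ∀ᶠ x in 𝓝 p, f x = f p → f (F x) = f (F p) ∧ G (F x) = x)
    (hGF : ∀ᶠ y in 𝓝 (F p), f y = f (F p) → f (G y) = f p ∧ F (G y) = y) : False := by
  have hnp := range_mem_nhds_isInteriorPoint hp
  have hnq := range_mem_nhds_isInteriorPoint hq
  have htarget : ∀ r : M, range I ∈ 𝓝 (extChartAt I r r) →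
      (extChartAt I r).target ∈ 𝓝 (extChartAt I r r) := fun r hr => by
    have h := extChartAt_target_mem_nhdsWithin (I := I) r
    rwa [nhdsWithin_eq_nhds.2 hr] at h
  have hcont : ∀ r : M, range I ∈ 𝓝 (extChartAt I r r) →
      ∀ᶠ y in 𝓝 (extChartAt I r r), ContinuousAt (f ∘ (extChartAt I r).symm) y := fun r hr => by
    filter_upwards [htarget r hr, eventually_eventually_nhds.2 hr] with y hy hy'
    exact (contDiffWithinAt_comp_extChartAt_symm hf.smooth r hy).continuousWithinAt.continuousAt hy'
  have hsymm : ∀ r : M, Tendsto (extChartAt I r).symm (𝓝 (extChartAt I r r)) (𝓝 r) := fun r => by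
    simpa using (continuousAt_extChartAt_symm (I := I) r).tendsto
  have hQ := hcp.isLittleO hf.smooth
  rw [nhdsWithin_eq_nhds.2 hnp] at hQ
  have hψ := ((contDiffWithinAt_comp_extChartAt_symm hf.smooth (F p)
    (mem_extChartAt_target (F p))).differentiableWithinAt (by simp)).hasFDerivWithinAt.hasFDerivAt hnq
  rw [isCriticalPt_iff hf.smooth] at hcq
  have hF' := (hF.differentiableWithinAt_writtenInExtChartAt.differentiableAt hnp).hasFDerivAt
  have hG' := (hG.differentiableWithinAt_writtenInExtChartAt.differentiableAt hnq).hasFDerivAt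
  simp only [writtenInExtChartAt, hGp] at hF' hG'
  refine not_diffeomorphic_regular_level_of_nondegenerate hE (hcont p hnp) (hcont (F p) hnq) hQ
    (chartHessian_symm hf.smooth p) (hf.nondegenerate p hcp) hψ hcq hF' hG' (by simp)
    (by simp [hGp]) ?_ ?_
  · have h1 : ∀ᶠ x in 𝓝 p, F x ∈ (extChartAt I (F p)).source :=
      hF.continuousAt.eventually (extChartAt_source_mem_nhds (I := I) (F p))
    filter_upwards [(hsymm p).eventually hFG, (hsymm p).eventually h1, htarget p hnp]
      with y hy hys hyt hfy
    have hL := (extChartAt I (F p)).left_inv hys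
    obtain ⟨h2, h3⟩ := hy (by simpa using hfy)
    simp only [Function.comp_apply, hL, h2, h3, extChartAt_to_inv, (extChartAt I p).right_inv hyt,
      and_self]
  · have h1 : ∀ᶠ y in 𝓝 (F p), G y ∈ (extChartAt I p).source :=
      hG.continuousAt.eventually (by rw [hGp]; exact extChartAt_source_mem_nhds (I := I) p)
    filter_upwards [(hsymm (F p)).eventually hGF, (hsymm (F p)).eventually h1, htarget (F p) hnq]
      with y hy hys hyt hfy
    have hL := (extChartAt I p).left_inv hys
    obtain ⟨h2, h3⟩ := hy (by simpa using hfy)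
    simp only [Function.comp_apply, hL, h2, h3, extChartAt_to_inv,
      (extChartAt I (F p)).right_inv hyt, and_self]

theorem exists_lt_and_exists_gt_of_isCriticalPt_boundary {n : ℕ} [NeZero n] (hn : 2 ≤ n)
    {M : Type*} [TopologicalSpace M] [ChartedSpace (EuclideanHalfSpace n) M]
    [IsManifold (𝓡∂ n) ∞ M] {f : M → ℝ} (hf : IsMorseFunction (𝓡∂ n) f) {p : M}
    (hp : p ∈ (𝓡∂ n).boundary M) (hc : IsCriticalPt (𝓡∂ n) f p)
    (hconst : ∀ᶠ x in 𝓝 p, x ∈ (𝓡∂ n).boundary M → f x = f p) :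
    (∃ x, f x < f p) ∧ ∃ x, f p < f x := by
  set x₀ := extChartAt (𝓡∂ n) p p with hx₀
  set φ := f ∘ (extChartAt (𝓡∂ n) p).symm with hφ
  have hφx₀ : φ x₀ = f p := congrArg f (extChartAt_to_inv p)
  have h0 : x₀ 0 = 0 := by
    have : x₀ ∈ frontier (range (𝓡∂ n)) := hp
    rw [frontier_range_modelWithCornersEuclideanHalfSpace] at this
    exact this.symm
  have hQ := hc.isLittleO hf.smooth
  rw [← hφ, ← hx₀] at hQ
  have hray : ∀ v : EuclideanSpace ℝ (Fin n), 0 ≤ v 0 →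
      ∀ᶠ t : ℝ in 𝓝[>] 0, x₀ + t • v ∈ range (𝓡∂ n) := by
    intro v hv
    filter_upwards [self_mem_nhdsWithin] with t (ht : 0 < t)
    rw [range_modelWithCornersEuclideanHalfSpace]
    simp only [mem_ofPred_eq, PiLp.add_apply, PiLp.smul_apply, h0, smul_eq_mul, zero_add]
    positivity
  have htend : ∀ v : EuclideanSpace ℝ (Fin n),
      Tendsto (fun t : ℝ => x₀ + t • v) (𝓝[>] 0) (𝓝 x₀) := fun v => by
    have : Continuous fun t : ℝ => x₀ + t • v := by fun_prop
    exact (this.tendsto' 0 x₀ (by simp)).mono_left nhdsWithin_le_nhds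
  set W := LinearMap.ker (EuclideanSpace.proj (𝕜 := ℝ) (0 : Fin n)).toLinearMap with hWdef
  have hWQ : ∀ w ∈ W, chartHessian (𝓡∂ n) f p w w = 0 := by
    intro w hw
    replace hw : w 0 = 0 := hw
    refine quadratic_eq_zero_of_constant_on_ray hQ (hray w hw.ge) ?_
    have h1 : Tendsto (fun t : ℝ => x₀ + t • w) (𝓝[>] 0) (𝓝[range (𝓡∂ n)] x₀) :=
      tendsto_nhdsWithin_iff.2 ⟨htend w, hray w hw.ge⟩
    have h2 : Tendsto (extChartAt (𝓡∂ n) p).symm (𝓝 x₀) (𝓝 p) := by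
      have := (continuousAt_extChartAt_symm (I := 𝓡∂ n) p).tendsto
      rwa [extChartAt_to_inv] at this
    filter_upwards [h1.eventually (extChartAt_target_mem_nhdsWithin (I := 𝓡∂ n) p),
      (h2.comp (htend w)).eventually hconst] with t ht htc
    rw [hφx₀]
    refine htc ?_
    have hsrc : (extChartAt (𝓡∂ n) p).symm (x₀ + t • w) ∈
        (chartAt (EuclideanHalfSpace n) p).source := by
      rw [← extChartAt_source (𝓡∂ n)]
      exact (extChartAt (𝓡∂ n) p).map_target ht
    -- Being a boundary point may be tested in the chart at `p`, where the ray stays in the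
    -- hyperplane of vanishing coordinate `0`.
    refine (ModelWithCorners.isBoundaryPoint_iff_of_mem_atlas (n := ∞) (by simp)
      (chart_mem_atlas (EuclideanHalfSpace n) p) hsrc).2 ?_
    change extChartAt (𝓡∂ n) p ((extChartAt (𝓡∂ n) p).symm (x₀ + t • w)) ∈
      frontier (extChartAt (𝓡∂ n) p).target
    rw [(extChartAt (𝓡∂ n) p).right_inv ht]
    refine ⟨subset_closure ht, fun hint => ?_⟩
    have := interior_mono (extChartAt_target_subset_range p) hint
    rw [interior_range_modelWithCornersEuclideanHalfSpace] at this
    simp [h0, hw] at this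
  set u : EuclideanSpace ℝ (Fin n) := EuclideanSpace.single 0 1 with hu
  set w : EuclideanSpace ℝ (Fin n) := EuclideanSpace.single ⟨1, by omega⟩ 1 with hw
  have hne : (0 : Fin n) ≠ ⟨1, by omega⟩ := by
    intro h
    simpa using congrArg Fin.val h
  have hu0 : u 0 = 1 := by simp [hu]
  have hw0 : w 0 = 0 := by simp [hw, hne]
  have hsup : W ⊔ Submodule.span ℝ {u} = ⊤ := by
    refine Submodule.eq_top_iff'.2 fun v => Submodule.mem_sup.2
      ⟨v - v 0 • u, ?_, v 0 • u, Submodule.smul_mem _ _ (Submodule.mem_span_singleton_self u),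
        by simp⟩
    change (v - v 0 • u) 0 = 0
    simp [hu0]
  have hwne : w ≠ 0 := by simp [hw]
  -- `u` points inward and `w` is tangent to the boundary, so all `u + c • w` are admissible
  -- directions.
  have key := exists_quadratic_eq_of_isotropic_hyperplane (chartHessian_symm hf.smooth p)
    (hf.nondegenerate p hc) hWQ hsup (show w ∈ W from hw0) hwne
  have hv : ∀ c : ℝ, 0 ≤ (u + c • w) 0 := fun c => by simp [hu0, hw0]
  constructor
  · obtain ⟨c, hc⟩ := key (-1)
    obtain ⟨t, ht⟩ := (eventually_gt_of_quadratic_neg hQ (hray _ (hv c)) (by rw [hc]; simp)).exists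
    exact ⟨_, hφx₀ ▸ ht⟩
  · obtain ⟨c, hc⟩ := key 1
    obtain ⟨t, ht⟩ := (eventually_lt_of_quadratic_pos hQ (hray _ (hv c)) (by rw [hc]; simp)).exists
    exact ⟨_, hφx₀ ▸ ht⟩

/-! ### The main theorem. -/

theorem lemma1 {n : ℕ} [NeZero n] (hn : 2 ≤ n)
    {M : Type*} [TopologicalSpace M] [T2Space M] [CompactSpace M]
    [ChartedSpace (EuclideanHalfSpace n) M] [IsManifold (𝓡∂ n) ∞ M]
    [RiemannianBundle (fun x : M => TangentSpace (𝓡∂ n) x)]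
    [IsContMDiffRiemannianBundle (𝓡∂ n) ∞ (EuclideanSpace ℝ (Fin n))
      (fun x : M => TangentSpace (𝓡∂ n) x)]
    (a b : ℝ) (f : M → ℝ)
    (hfab : ∀ x, f x ∈ Icc a b)
    (hf : IsMorseFunction (𝓡∂ n) f)
    (hbdry : f '' (𝓡∂ n).boundary M = {a, b})
    (hlevel : ∀ c ∈ Icc a b, ∀ d ∈ Icc a b,
      DiffeomorphicSubsets (𝓡∂ n) (f ⁻¹' {c}) (f ⁻¹' {d})) :
    (∀ x, ¬ IsCriticalPt (𝓡∂ n) f x) ∧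
      ∃ C : ℝ, 0 < C ∧ ∀ x, C ≤ ‖riemannianGradient (𝓡∂ n) f x‖ := by
  have hval : ∀ x ∈ (𝓡∂ n).boundary M, f x = a ∨ f x = b := fun x hx => by
    have : f x ∈ ({a, b} : Set ℝ) := hbdry ▸ mem_image_of_mem f hx
    simpa using this
  have hbd : ∀ p ∈ (𝓡∂ n).boundary M, ¬ IsCriticalPt (𝓡∂ n) f p := by
    intro p hp hc
    have hconst : ∀ᶠ x in 𝓝 p, x ∈ (𝓡∂ n).boundary M → f x = f p := by
      have hfin : (({a, b} : Set ℝ) \ {f p}).Finite := (toFinite _).sdiff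
      -- Boundary values lie in a finite set, so by continuity only `f p` occurs near `p`.
      have h1 : (({a, b} : Set ℝ) \ {f p})ᶜ ∈ 𝓝 (f p) :=
        hfin.isClosed.isOpen_compl.mem_nhds (by simp)
      filter_upwards [hf.smooth.continuous.continuousAt h1] with x hx hxb
      by_contra hne
      exact hx ⟨by simpa using hval x hxb, hne⟩
    obtain ⟨⟨x, hx⟩, y, hy⟩ := exists_lt_and_exists_gt_of_isCriticalPt_boundary hn hf hp hc hconst
    rcases hval p hp with h | h
    · exact (hfab x).1.not_gt (h ▸ hx)
    · exact (hfab y).2.not_gt (h ▸ hy)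
  obtain ⟨p₀, hp₀, hfp₀⟩ : a ∈ f '' (𝓡∂ n).boundary M := by simp [hbdry]
  -- If `a = b` then `f` is constant and the boundary point `p₀` is critical.
  have hab : a < b := by
    refine lt_of_le_of_ne ((hfab p₀).1.trans (hfab p₀).2) fun h => hbd p₀ hp₀ ?_
    have : f = fun _ => a := funext fun x => le_antisymm ((hfab x).2.trans h.ge) (hfab x).1
    rw [IsCriticalPt, this]
    exact mfderiv_const
  have hcrit : ∀ x, ¬ IsCriticalPt (𝓡∂ n) f x := by
    intro p hcp
    have hp : (𝓡∂ n).IsInteriorPoint p :=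
      (ModelWithCorners.isInteriorPoint_iff_not_isBoundaryPoint p).2 fun h => hbd p h hcp
    -- A regular value strictly between `a` and `b`, so that its level also avoids the boundary.
    obtain ⟨d, hd, hdreg⟩ :=
      ((Ioo_infinite hab).sdiff (hf.finite_setOf_isCriticalPt.image f)).nonempty
    obtain ⟨e, he, he'⟩ := hlevel (f p) (hfab p) d (Ioo_subset_Icc_self hd)
    have hfe : ∀ x, f (e x) = d := fun x => (e x).2
    have hfe' : ∀ y, f (e.symm y) = f p := fun y => (e.symm y).2
    obtain ⟨U, hU, hpU, F, hFU, hF⟩ := he ⟨p, rfl⟩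
    obtain ⟨V, hV, hqV, G, hGV, hG⟩ := he' (e ⟨p, rfl⟩)
    have hFp : F p = e ⟨p, rfl⟩ := hF ⟨p, rfl⟩ hpU
    have hfFp : f (F p) = d := by rw [hFp, hfe]
    rw [← hFp] at hqV
    have hFd : ContMDiffAt (𝓡∂ n) (𝓡∂ n) ∞ F p := hFU.contMDiffAt (hU.mem_nhds hpU)
    have hGd : ContMDiffAt (𝓡∂ n) (𝓡∂ n) ∞ G (F p) := hGV.contMDiffAt (hV.mem_nhds hqV)
    have hGe : ∀ y (hy : f y = d), y ∈ V → G y = e.symm ⟨y, hy⟩ := fun y hy hyV => hG ⟨y, hy⟩ hyV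
    have hFe : ∀ x (hx : f x = f p), x ∈ U → F x = e ⟨x, hx⟩ := fun x hx hxU => hF ⟨x, hx⟩ hxU
    have hGp : G (F p) = p := by
      rw [hGe _ hfFp hqV]
      simp [hFp]
    have hq : (𝓡∂ n).IsInteriorPoint (F p) := by
      refine (ModelWithCorners.isInteriorPoint_iff_not_isBoundaryPoint _).2 fun h => ?_
      rcases hval _ h with h | h
      · exact hd.1.ne' (hfFp ▸ h)
      · exact hd.2.ne (hfFp ▸ h)
    refine no_local_diffeomorphism_critical_regular (by simpa using hn) hf hp hq hcp
      (fun h => hdreg ⟨_, h, hfFp⟩) (hFd.mdifferentiableAt (by simp))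
      (hGd.mdifferentiableAt (by simp)) hGp ?_ ?_
    · filter_upwards [hU.mem_nhds hpU, hFd.continuousAt (hV.mem_nhds hqV)] with x hxU hxV hx
      have h1 := hFe x hx hxU
      have h2 : f (F x) = d := by rw [h1, hfe]
      refine ⟨h2.trans hfFp.symm, ?_⟩
      rw [hGe _ h2 hxV]
      simp [h1]
    · have hGU : G ⁻¹' U ∈ 𝓝 (F p) := hGd.continuousAt (by rw [hGp]; exact hU.mem_nhds hpU)
      filter_upwards [hV.mem_nhds hqV, hGU] with y hyV hyU hy
      have h1 := hGe y (hy.trans hfFp) hyV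
      have h2 : f (G y) = f p := by rw [h1, hfe']
      refine ⟨h2, ?_⟩
      rw [hFe _ h2 hyU]
      simp [h1]
  exact ⟨hcrit, exists_gradient_bound hf.smooth hcrit⟩
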